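/- For $n\ge 1$ let $$v_n=\Big[(1-x)\prod_{j=0}^{2n-3}(2n-3-j+jx)\Big]_{x^{n-1}},$$ where $[f(x)]_{x^m}$ denotes the coefficient of $x^m$ in the polynomial $f(x)$ (for $n=1$ the product is empty, so $v_1=1$), and put $v_0=-1$. For an integer $k\ge 1$ the table of $v_n$ mod $k$ is the array with rows $i=1,\ldots,k$ and columns indexed by $l=0,1,2,\ldots$ whose entry in row $i$ and column $l$ is $t_k(i,l)$, the residue of $v_{lk+i}$ modulo $k$ in $\{0,1,\ldots,k-1\}$. We use the notation $t_k(i,l)$ for every integer $i\ge 0$. Then the following holds. 1. $v_n$ is odd for every $n\ge 0$. 2. For every $k\ge 1$ the first two rows of the table are equal: $t_k(1,l)=t_k(2,l)$ for all $l\ge 0$. 3. If $k\geq 1$ is even, then rows $k/2+1$ and $k/2+2$ are equal: $t_k(k/2+1,l)=t_k(k/2+2,l)$ for all $l\ge 0$. 4. If $k\geq 1$ is odd, then row $(k+3)/2$ contains only zeros: $t_k((k+3)/2,l)=0$ for all $l\ge 0$. 5. If $k$ is prime, then each of the first two rows starts with $1,1$ followed by $k$ entries equal to $k-1$: for $i\in\{1,2\}$,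 $t_k(i,0)=t_k(i,1)=1$ and $t_k(i,l)=k-1$ for $2\le l\le k+1$. 6. If $k>2$ is prime, then the last $(k-1)/2$ entries of the first column vanish: $t_k(i,0)=0$ for $(k+3)/2\le i\le k$. 7. If $k>2$ is prime, then, after the first $(k-1)/2$ columns, there is a block of zeros at the bottom of the table, of height $(k-1)/2$ and width $(k+3)/2$: $t_k(i,l)=0$ for $(k+3)/2\le i\le k$ and $(k-1)/2\le l<(k-1)/2+(k+3)/2$. 8. If $k=2^q$ with $q\ge 1$, then all rows are constant, i.e. $t_k(i,l)=t_k(i,0)$ for all $i,l\ge 0$ (so that $v_{l2^q+i}\equiv v_i\pmod{2^q}$), and for every odd integer $a$ with $1\le a\le 2^q$ there are precisely two rows $i\in\{1,\ldots,2^q\}$ all of whose entries are equal to $a$. 9. If $k=2^q$ with $q\ge 2$, then all entries in the rows $1,\ 2,\ 2^{q-1},\ 2^{q-1}+1,\ 2^{q-1}+2,\ 2^q$ are equal to, respectively, $1,\ 1,\ 2^{q-1}-1,\ 2^{q-1}+1,\ 2^{q-1}+1,\ 2^q-1$. 10. If $k=2^q$ with $q\ge 2$, then rows $i$ and $i+2^{q-1}$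 differ by $2^{q-1}$ modulo $2^q$: $t_k(i+2^{q-1},l)\equiv t_k(i,l)+2^{q-1}\pmod{2^q}$ for all $i,l\ge 0$ (in particular $v_{2^{q-1}+i}\equiv v_i+2^{q-1}\pmod{2^q}$). -/

import Mathlib

open Polynomial in
/-- The integers `v_n`: for `n ≥ 1`, the coefficient of `x ^ (n - 1)` in
`(1 - x) * ∏_{j = 0}^{2 n - 3} (2 n - 3 - j + j x)`, and `v_0 = -1` by convention.
The product has `2 n - 2` factors; it is empty for `n = 1`, so that `v_1 = 1`.
The numbers `2 n - 3 - j` are computed in `ℤ`. -/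
noncomputable def lineNumber (n : ℕ) : ℤ :=
  if n = 0 then -1
  else
    ((1 - X) * ∏ j ∈ Finset.range (2 * n - 2),
      (C (2 * (n : ℤ) - 3 - (j : ℤ)) + C (j : ℤ) * X) : ℤ[X]).coeff (n - 1)

/-- The entry of the table of `v_n` mod `k` in row `i` (the rows being numbered `1, …, k`) and
in the column with index `l = 0, 1, 2, …`: the residue of `v_{l k + i}` in `{0, …, k - 1}`.
The same formula is used for row indices outside `1, …, k`. -/
noncomputable def tableEntry (k i l : ℕ) : ℤ :=
  lineNumber (l * k + i) % (k : ℤ)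

/-!
Put `y = x - 1` and `D = 2 n - 3`. The `j`-th factor of the product defining `v_n` is `D + j y`,
so modulo `k` the factors depend only on `D` and `j` modulo `k`. Hence the product splits into
full periods and a remainder (`lineProd_add_mul`), and for a unit `D` a full period is a constant
times `G = ∏_{j < k} (1 + j y)` (`lineProd_period`). The claims for general `k` follow at once: if
`D ≡ -1`, then `v_n` is a coefficient of `(1 - x) G ^ m`; if `D ≡ 1`, there are two further factors
with product `x`, and the coefficient is the same; if `D ≡ 0`, the factor `j = 0` vanishes.

For a prime `k = p`, the polynomial `G` is `1 - y ^ (p - 1)`, or `-(x + ⋯ + x ^ (p - 1))`, and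
`y ^ p = x ^ p - 1`. The zeros at the bottom of the first column come from `(1 - x) G = x ^ p - x`
and a comparison of degrees. For exponents `e = p + b` one has `G ^ p = G(x ^ p)`, while `G ^ b`
agrees with `1` modulo `y ^ (p - 1)`, so that `(1 - x) F G ^ b = (1 - x) F + (x ^ p - 1) Q` for any
`F`. As `G(x ^ p) (x ^ p - 1) = x ^ p - x ^ (p ^ 2)`, the coefficients of `(1 - x) F G ^ e` are those
of `(1 - x) F G(x ^ p)`, corrected by two coefficients of `Q`, which are controlled by its degree and
by the divisibility of `G` by `x` (`exists_mul_lineProd_pow`). This gives the block of zeros and the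
second half of the entries `p - 1` in the first row; the first half is a binomial expansion of `G`
in powers of `y`.

For `k = 2 ^ q` with `q ≥ 2` and `M = 2 ^ (q - 1)`, everything follows from
`v_{n + M} ≡ v_n + M` modulo `2 ^ q` (`lineNumber_add_two_pow_modEq`). Pairing the factors `j` and
`j + M` shows that passing from `q` to `q + 1` squares `G`, so
`G ≡ x ^ M + M (x ^ (M - 1) + x ^ (M + 1) + e (x ^ (M - 2) + x ^ (M + 2)))` with some constant `e`.
Replacing `n` by `n + M` multiplies the product by `G`; as the product for `n` is `x ^ (n - 1)`
modulo 2, the congruence for `n ≥ 1` is read off. For `n = 0` the product `f` for `v_M` satisfies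
`(2 x + 1) (x + 2) f ≡ G`, and dividing by `2 x + 1` from below and by `x + 2` from above gives the
two coefficients that determine `v_M` (`cast_lineNumber_two_pow`).
-/

open Polynomial in
/-- The product `∏_{j < m} (d + j (x - 1))`. For `d = 2 n - 3` and `m = 2 n - 2` it is the product
in the definition of `v_n`. -/
noncomputable def lineProd {R : Type*} [CommRing R] (d : R) (m : ℕ) : R[X] :=
  ∏ j ∈ Finset.range m, (C d + C (j : R) * (X - 1))

/-! ### The product modulo `k` -/

section General

open Polynomial

theorem lineProd_succ {R : Type*} [CommRing R] (d : R) (m : ℕ) :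
    lineProd d (m + 1) = lineProd d m * (C d + C (m : R) * (X - 1)) :=
  Finset.prod_range_succ _ _

theorem map_lineProd {R S : Type*} [CommRing R] [CommRing S] (φ : R →+* S) (d : R) (m : ℕ) :
    (lineProd d m).map φ = lineProd (φ d) m := by
  simp [lineProd, Polynomial.map_prod]

theorem lineNumber_eq_coeff {n : ℕ} (hn : n ≠ 0) :
    lineNumber n =
      ((1 - X) * lineProd (2 * (n : ℤ) - 3) (2 * n - 2)).coeff (n - 1) := by
  rw [lineNumber, if_neg hn, lineProd]
  congr 2
  refine Finset.prod_congr rfl fun j _ => ?_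
  simp only [map_sub, map_mul]
  simp
  ring

theorem cast_lineNumber (R : Type*) [CommRing R] {n : ℕ} (hn : n ≠ 0) :
    (lineNumber n : R) =
      ((1 - X) * lineProd (2 * (n : R) - 3) (2 * n - 2)).coeff (n - 1) := by
  have h := congrArg (Int.castRingHom R) (lineNumber_eq_coeff hn)
  rw [← Polynomial.coeff_map, Polynomial.map_mul, map_lineProd] at h
  simpa using h

theorem lineNumber_zero : lineNumber 0 = -1 := by simp [lineNumber]

theorem lineNumber_one : lineNumber 1 = 1 := by simp [lineNumber]

/-- The factor `j = 0` is constant, which saves one degree. -/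
theorem natDegree_lineProd_le {R : Type*} [CommRing R] (d : R) (m : ℕ) :
    (lineProd d m).natDegree ≤ m - 1 := by
  rcases m with _ | m
  · simp [lineProd]
  rw [lineProd, Finset.prod_range_succ']
  refine natDegree_mul_le.trans ?_
  have h0 : (C d + C ((0 : ℕ) : R) * (X - 1)).natDegree = 0 := by simp
  rw [h0, add_zero]
  refine (natDegree_prod_le _ _).trans ((Finset.sum_le_card_nsmul _ _ 1 ?_).trans (by simp))
  intro j _
  compute_degree

theorem lineProd_zero_left {R : Type*} [CommRing R] {m : ℕ} (hm : m ≠ 0) :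
    lineProd (0 : R) m = 0 :=
  Finset.prod_eq_zero (Finset.mem_range.2 (Nat.pos_of_ne_zero hm)) (by simp)

/-- Modulo `k` the factors of the product are periodic in `j`. -/
theorem lineProd_add_mul {k : ℕ} (d : ZMod k) (m l : ℕ) :
    lineProd d (m + k * l) = lineProd d m * lineProd d k ^ l := by
  have hper : ∀ a b : ℕ, lineProd d (k * b + a) = lineProd d (k * b) * lineProd d a := by
    intro a b
    rw [lineProd, lineProd, lineProd, Finset.prod_range_add]
    simp
  rw [add_comm, hper, mul_comm]
  congr 1
  induction l with
  | zero => simp [lineProd]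
  | succ l ih => rw [mul_add, mul_one, hper, ih, pow_succ]

theorem prod_range_natCast_zmod {k : ℕ} [NeZero k] {M : Type*} [CommMonoid M] (F : ZMod k → M) :
    ∏ j ∈ Finset.range k, F (j : ZMod k) = ∏ a : ZMod k, F a := by
  refine Finset.prod_bij' (fun j _ => (j : ZMod k)) (fun a _ => a.val) ?_ ?_ ?_ ?_ ?_
  · simp
  · intro a _; simpa using ZMod.val_lt a
  · intro j hj; exact ZMod.val_cast_of_lt (Finset.mem_range.1 hj)
  · simp
  · simp

/-- For a unit `d`, the substitution `j ↦ d j` in a full period extracts `d` from every factor. -/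
theorem lineProd_period {k : ℕ} [NeZero k] {d : ZMod k} (hd : IsUnit d) :
    lineProd d k = C (d ^ k) * lineProd 1 k := by
  obtain ⟨u, rfl⟩ := hd
  rw [lineProd, lineProd, prod_range_natCast_zmod (fun a => C (u : ZMod k) + C a * (X - 1)),
    prod_range_natCast_zmod (fun a => C (1 : ZMod k) + C a * (X - 1)),
    ← Equiv.prod_comp (Units.mulLeft u)]
  have h : ∀ a : ZMod k, C (u : ZMod k) + C (Units.mulLeft u a) * (X - 1) =
      C (u : ZMod k) * (C 1 + C a * (X - 1)) := by
    intro a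
    simp only [Units.mulLeft_apply, map_mul, map_one]
    ring
  simp_rw [h, Finset.prod_mul_distrib]
  simp

theorem tableEntry_eq_iff {k i j l m : ℕ} :
    tableEntry k i l = tableEntry k j m ↔
      (lineNumber (l * k + i) : ZMod k) = lineNumber (m * k + j) :=
  (ZMod.intCast_eq_intCast_iff _ _ _).symm

theorem tableEntry_eq_zero_iff {k i l : ℕ} :
    tableEntry k i l = 0 ↔ (lineNumber (l * k + i) : ZMod k) = 0 := by
  rw [ZMod.intCast_zmod_eq_zero_iff_dvd, tableEntry]
  exact (Int.dvd_iff_emod_eq_zero).symm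

theorem tableEntry_eq_of_cast {k i l : ℕ} {a : ℤ} (h0 : 0 ≤ a) (hk : a < k)
    (h : (lineNumber (l * k + i) : ZMod k) = a) : tableEntry k i l = a := by
  rw [tableEntry, (ZMod.intCast_eq_intCast_iff _ _ _).1 h, Int.emod_eq_of_lt h0 hk]

/-- Here `2 n - 3 ≡ -1` modulo `k`, and `2 n - 2` factors make up `m` full periods. The parity
condition makes the sign `(-1) ^ (k m)` disappear. -/
theorem cast_lineNumber_of_neg_one {k n m : ℕ} [NeZero k] (hm : Even (k * m))
    (h : 2 * n = k * m + 2) :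
    (lineNumber n : ZMod k) =
      ((1 - X) * lineProd (1 : ZMod k) k ^ m).coeff (n - 1) := by
  rw [cast_lineNumber _ (by omega), show 2 * n - 2 = 0 + k * m by omega, lineProd_add_mul]
  have h2 : 2 * (n : ZMod k) - 3 = -1 := by
    have := congrArg (Nat.cast : ℕ → ZMod k) h
    push_cast at this
    rw [this, ZMod.natCast_self]; ring
  rw [h2, lineProd_period isUnit_one.neg, mul_pow, ← C_pow, ← pow_mul, hm.neg_one_pow]
  simp [lineProd]

/-- Here `2 n - 3 ≡ 1` modulo `k`; besides `m` full periods there are the two factors `1` and `x`. -/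
theorem cast_lineNumber_of_one {k n m : ℕ} (h : 2 * n = k * m + 4) :
    (lineNumber n : ZMod k) =
      ((1 - X) * lineProd (1 : ZMod k) k ^ m).coeff (n - 2) := by
  rw [cast_lineNumber _ (by omega), show 2 * n - 2 = 2 + k * m by omega, lineProd_add_mul]
  have h2 : 2 * (n : ZMod k) - 3 = 1 := by
    have := congrArg (Nat.cast : ℕ → ZMod k) h
    push_cast at this
    rw [this, ZMod.natCast_self]; ring
  have h3 : lineProd (1 : ZMod k) 2 = X := by
    rw [lineProd_succ, lineProd_succ]
    simp [lineProd]
  rw [h2, h3, mul_left_comm, show n - 1 = n - 2 + 1 by omega, coeff_X_mul]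

theorem tableEntry_one_eq_tableEntry_two {k : ℕ} (hk : 1 ≤ k) (l : ℕ) :
    tableEntry k 1 l = tableEntry k 2 l := by
  have : NeZero k := ⟨by omega⟩
  rw [tableEntry_eq_iff,
    cast_lineNumber_of_neg_one (m := 2 * l) ((even_two_mul l).mul_left k) (by ring),
    cast_lineNumber_of_one (m := 2 * l) (by ring)]
  rfl

theorem tableEntry_half_rows {k : ℕ} (hk : 1 ≤ k) (he : Even k) (l : ℕ) :
    tableEntry k (k / 2 + 1) l = tableEntry k (k / 2 + 2) l := by
  have : NeZero k := ⟨by omega⟩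
  obtain ⟨c, rfl⟩ := he.two_dvd
  rw [tableEntry_eq_iff, Nat.mul_div_cancel_left c two_pos,
    cast_lineNumber_of_neg_one (m := 2 * l + 1) (he.mul_right _) (by ring),
    cast_lineNumber_of_one (m := 2 * l + 1) (by ring)]
  rfl

theorem tableEntry_middle_row {k : ℕ} (ho : Odd k) (l : ℕ) :
    tableEntry k ((k + 3) / 2) l = 0 := by
  obtain ⟨c, hc⟩ := ho
  have h1 : (k + 3) / 2 = c + 2 := by omega
  rw [tableEntry_eq_zero_iff, h1, cast_lineNumber _ (by omega)]
  have h2 : 2 * ((l * k + (c + 2) : ℕ) : ZMod k) - 3 = 0 := by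
    have h3 : 2 * (l * k + (c + 2)) = k * (2 * l + 1) + 3 := by rw [hc]; ring
    have := congrArg (Nat.cast : ℕ → ZMod k) h3
    rw [Nat.cast_mul] at this
    simp only [Nat.cast_ofNat] at this
    rw [this]
    simp
  rw [h2, lineProd_zero_left (by omega)]
  simp

end General

/-! ### The product over a full period modulo a prime -/

section PrimeModulus

open Polynomial

variable {p : ℕ} [Fact p.Prime]

/-- Both sides have degree less than `p` and agree at all `p` points of the prime field. -/
theorem lineProd_one_prime :
    lineProd (1 : ZMod p) p = 1 - (X - 1) ^ (p - 1) := by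
  have hp := Fact.out (p := p.Prime)
  have hdeg := natDegree_lineProd_le (1 : ZMod p) p
  refine eq_of_natDegree_lt_card_of_eval_eq _ _ (f := (id : ZMod p → ZMod p))
    Function.injective_id (fun x => ?_) ?_
  · rw [lineProd, prod_range_natCast_zmod (fun a => C (1 : ZMod p) + C a * (X - 1)), eval_prod]
    by_cases hx : x - 1 = 0
    · simp [hx, Nat.sub_ne_zero_of_lt hp.one_lt]
    · rw [Finset.prod_eq_zero (Finset.mem_univ (-(x - 1)⁻¹))]
      · simp [ZMod.pow_card_sub_one_eq_one hx]
      · simp [inv_mul_cancel₀ hx]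
  · rw [ZMod.card]
    refine max_lt (by have := hp.one_lt; omega) (lt_of_le_of_lt ?_ (Nat.sub_one_lt hp.ne_zero))
    compute_degree

theorem X_sub_one_mul_lineProd :
    (X - 1) * lineProd (1 : ZMod p) p = X - X ^ p := by
  have hp := Fact.out (p := p.Prime)
  rw [lineProd_one_prime, mul_sub, ← pow_succ', Nat.sub_add_cancel hp.one_le, sub_pow_char]
  ring

theorem X_dvd_lineProd_one : (X : (ZMod p)[X]) ∣ lineProd (1 : ZMod p) p := by
  rw [X_dvd_iff, coeff_zero_eq_eval_zero]
  have h := congrArg (eval 0) (X_sub_one_mul_lineProd (p := p))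
  simpa [(Fact.out (p := p.Prime)).ne_zero] using h

/-- In `h(x) F(x ^ p)` with `deg h < p` there is only one way to write an exponent. -/
theorem coeff_mul_expand {R : Type*} [CommRing R] {p s : ℕ} (h F : R[X])
    (hh : h.natDegree < p) (hs : s < p) (l : ℕ) :
    (h * expand R p F).coeff (l * p + s) = h.coeff s * F.coeff l := by
  induction F using Polynomial.induction_on' with
  | add F G hF hG => rw [map_add, mul_add, coeff_add, hF, hG, coeff_add, mul_add]
  | monomial n a =>
    rw [expand_monomial, ← C_mul_X_pow_eq_monomial, ← mul_assoc, coeff_mul_X_pow', coeff_mul_C,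
      coeff_monomial]
    rcases lt_trichotomy n l with hnl | rfl | hnl
    · have h1 : (n + 1) * p ≤ l * p := Nat.mul_le_mul_right p hnl
      rw [add_mul] at h1
      rw [if_neg hnl.ne, coeff_eq_zero_of_natDegree_lt (p := h) (by omega)]
      simp
    · simp
    · have h1 : (l + 1) * p ≤ n * p := Nat.mul_le_mul_right p hnl
      rw [add_mul] at h1
      rw [if_neg hnl.ne', if_neg (by omega), mul_zero]

theorem coeff_lineProd_one (n : ℕ) :
    (lineProd (1 : ZMod p) p).coeff n = if 1 ≤ n ∧ n < p then -1 else 0 := by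
  have hp := Fact.out (p := p.Prime)
  have h : (X - 1) * lineProd (1 : ZMod p) p =
      (X - 1) * -(X * ∑ i ∈ Finset.range (p - 1), (X : (ZMod p)[X]) ^ i) := by
    rw [X_sub_one_mul_lineProd, mul_neg, mul_left_comm, mul_geom_sum, mul_sub, ← pow_succ',
      Nat.sub_add_cancel hp.one_le]
    ring
  rw [mul_left_cancel₀ (X_sub_C_ne_zero (1 : ZMod p)) h]
  rcases n with _ | n
  · simp
  · rw [coeff_neg, coeff_X_mul, finsetSum_coeff]
    simp only [coeff_X_pow, Finset.sum_ite_eq, Finset.mem_range]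
    by_cases h : n < p - 1
    · rw [if_pos h, if_pos (by omega)]
    · rw [if_neg h, if_neg (by omega), neg_zero]

/-- For `e = p + b`, write `B * G ^ b = B + (X ^ p - 1) * Q`, where `G = lineProd 1 p` and
`B = (1 - X) * F`. Since `G ^ p = G(X ^ p)`, multiplication by `G ^ p` telescopes the second
summand. -/
theorem exists_mul_lineProd_pow (F : (ZMod p)[X]) (b : ℕ) :
    ∃ Q : (ZMod p)[X],
      (1 - X) * F * lineProd (1 : ZMod p) p ^ b = (1 - X) * F + (X ^ p - 1) * Q ∧
      (1 - X) * F * lineProd (1 : ZMod p) p ^ (p + b) =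
        (1 - X) * F * expand (ZMod p) p (lineProd (1 : ZMod p) p) +
          (X ^ p - X ^ (p * p)) * Q := by
  have hp := Fact.out (p := p.Prime)
  obtain ⟨T, hT⟩ := sub_one_dvd_pow_sub_one (lineProd (1 : ZMod p) p) b
  have hY : (1 - X) * (lineProd (1 : ZMod p) p - 1) = X ^ p - 1 := by
    have := X_sub_one_mul_lineProd (p := p)
    linear_combination -this
  have h1 : (1 - X) * F * lineProd (1 : ZMod p) p ^ b = (1 - X) * F + (X ^ p - 1) * (F * T) := by
    linear_combination (1 - X) * F * hT + F * T * hY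
  have h2 : (X ^ p - 1) * lineProd (1 : ZMod p) p ^ p = X ^ p - X ^ (p * p) := by
    have := congrArg (expand (ZMod p) p) (X_sub_one_mul_lineProd (p := p))
    rw [map_mul, ZMod.expand_card (lineProd _ _)] at this
    simpa [← pow_mul] using this
  refine ⟨F * T, h1, ?_⟩
  rw [ZMod.expand_card, pow_add]
  linear_combination lineProd (1 : ZMod p) p ^ p * h1 + F * T * h2

/-- The degree of the quotient of `A - B` by `x ^ p - 1`. -/
theorem natDegree_add_le_of_mul_eq {R : Type*} [CommRing R] [Nontrivial R] {p N : ℕ} (hp : p ≠ 0)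
    {A B Q : R[X]} (h : A = B + (X ^ p - 1) * Q) (hA : A.natDegree ≤ N) (hB : B.natDegree ≤ N)
    (hQ : Q ≠ 0) : Q.natDegree + p ≤ N := by
  have hm : (X ^ p - 1 : R[X]).Monic := monic_X_pow_sub_C 1 hp
  have h1 : (X ^ p - 1 : R[X]).natDegree = p := natDegree_X_pow_sub_C
  have h2 : (X ^ p - 1) * Q = A - B := by rw [h]; ring
  have h3 := hm.natDegree_mul' hQ
  rw [h1, h2] at h3
  have := natDegree_sub_le_of_le hA hB
  omega

end PrimeModulus

/-! ### Tables modulo a prime -/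

section PrimeTables

open Polynomial

theorem sum_choose_mul_X_sub_one_pow (R : Type*) [CommRing R] (m : ℕ) :
    ∑ j ∈ Finset.range m, C (m.choose (j + 1) : R) * (X - 1) ^ j =
      ∑ i ∈ Finset.range m, (X : R[X]) ^ i := by
  have h := congrArg (compRingHom (X - 1)) (geom_sum_X_comp_X_add_one_eq_sum (R := R) m)
  rw [coe_compRingHom_apply, comp_assoc, map_sum] at h
  simpa using h.symm

variable {p : ℕ} [Fact p.Prime]

/-- Expand `G ^ m = (1 - (x - 1) ^ (p - 1)) ^ m` by the binomial theorem and use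
`(x - 1) ^ p = x ^ p - 1`: only the constant terms of the remaining powers of `x - 1` matter. -/
theorem coeff_one_sub_X_mul_lineProd_pow_of_le (hp2 : p ≠ 2) {m l : ℕ} (hl : 1 ≤ l) (hlm : l < m)
    (hm2 : 2 ≤ m) (hm : m ≤ p + 1) :
    ((1 - X) * lineProd (1 : ZMod p) p ^ m).coeff (l * p) =
      if l = 1 then (m : ZMod p) - 1 else -1 := by
  have hp := Fact.out (p := p.Prime)
  have hpo : Odd p := hp.odd_of_ne_two hp2
  have hp1 := hp.one_lt
  obtain ⟨c, rfl⟩ : ∃ c, m = c + 2 := ⟨m - 2, by omega⟩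
  -- the terms with exponents at least 2 of `(x - 1) ^ (p - 1)`
  have hhigh : ∀ j ∈ Finset.range (c + 1),
      ((1 - X) * ((-(X - 1) ^ (p - 1)) ^ (j + 2) * 1 ^ (c + 2 - (j + 2)) *
        ((c + 2).choose (j + 2) : (ZMod p)[X]))).coeff (l * p) =
      -(C ((c + 2).choose (j + 1 + 1) : ZMod p) * (X - 1) ^ (j + 1)).coeff l := by
    intro j hj
    rw [Finset.mem_range] at hj
    have hjp : j ≤ p - 1 := by omega
    have e1 : (1 - X) * ((-(X - 1) ^ (p - 1)) ^ (j + 2) * 1 ^ (c + 2 - (j + 2)) *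
        ((c + 2).choose (j + 2) : (ZMod p)[X])) =
        C (-(-1) ^ j : ZMod p) * ((X - 1) ^ (p - 1 - j) *
          expand (ZMod p) p (C ((c + 2).choose (j + 1 + 1) : ZMod p) * (X - 1) ^ (j + 1))) := by
      have e2 : (X - 1 : (ZMod p)[X]) * ((X - 1) ^ (p - 1)) ^ (j + 2) =
          (X - 1) ^ (p - 1 - j) * (X ^ p - 1) ^ (j + 1) := by
        have e3 : (X ^ p - 1 : (ZMod p)[X]) = (X - 1) ^ p := by rw [sub_pow_char]; simp
        rw [e3, ← pow_mul, ← pow_mul, ← pow_succ', ← pow_add]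
        congr 1
        obtain ⟨d, rfl⟩ : ∃ d, p = d + 1 := ⟨p - 1, by omega⟩
        obtain ⟨e, rfl⟩ : ∃ e, d = j + e := ⟨d - j, by omega⟩
        simp only [Nat.add_sub_cancel, Nat.add_sub_cancel_left]
        ring
      rw [map_mul, map_pow, map_sub, map_one, expand_X, expand_C, neg_pow]
      simp only [map_neg, map_pow, map_one, one_pow, mul_one, map_natCast]
      linear_combination (-(-1) ^ j * ((c + 2).choose (j + 2) : (ZMod p)[X])) * e2
    have hdeg : ((X - 1 : (ZMod p)[X]) ^ (p - 1 - j)).natDegree < p := by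
      refine lt_of_le_of_lt (b := p - 1) ?_ (by omega)
      refine natDegree_pow_le.trans ?_
      have : (X - 1 : (ZMod p)[X]).natDegree ≤ 1 := by compute_degree
      calc _ ≤ (p - 1 - j) * 1 := Nat.mul_le_mul_left _ this
        _ ≤ p - 1 := by omega
    have h0 : ((X - 1 : (ZMod p)[X]) ^ (p - 1 - j)).coeff 0 = (-1) ^ j := by
      rw [coeff_zero_eq_eval_zero, eval_pow]
      simp only [eval_sub, eval_X, eval_one, zero_sub]
      obtain ⟨e, he⟩ : ∃ e, p = j + e + 1 := ⟨p - 1 - j, by omega⟩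
      have he2 : Even (j + e) := by
        rcases hpo with ⟨t, ht⟩
        exact ⟨t, by omega⟩
      rw [show p - 1 - j = e by omega]
      exact neg_one_pow_congr ((Nat.even_add.1 he2).symm)
    rw [e1, coeff_C_mul, show l * p = l * p + 0 from rfl, coeff_mul_expand _ _ hdeg hp.pos, h0]
    rw [← mul_assoc, neg_mul, ← mul_pow]
    simp
  rw [lineProd_one_prime, sub_eq_neg_add (1 : (ZMod p)[X]) ((X - 1) ^ (p - 1)), add_pow,
    Finset.mul_sum, finsetSum_coeff,
    Finset.sum_range_succ', Finset.sum_range_succ', Finset.sum_congr rfl hhigh,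
    Finset.sum_neg_distrib]
  have hS := congrArg (fun f => coeff f l) (sum_choose_mul_X_sub_one_pow (ZMod p) (c + 2))
  simp only [finsetSum_coeff] at hS
  rw [Finset.sum_range_succ'] at hS
  have hR : ∑ i ∈ Finset.range (c + 2), ((X : (ZMod p)[X]) ^ i).coeff l = 1 := by
    simp [coeff_X_pow, hlm]
  rw [hR] at hS
  have h00 : (C ((c + 2).choose (0 + 1) : ZMod p) * (X - 1) ^ 0).coeff l = 0 := by
    rw [pow_zero, mul_one, coeff_C, if_neg (by omega)]
  rw [h00, add_zero] at hS
  rw [hS]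
  have hlow1 : ((1 - X) * ((-(X - 1) ^ (p - 1)) ^ (0 + 1) * 1 ^ (c + 2 - (0 + 1)) *
        ((c + 2).choose (0 + 1) : (ZMod p)[X]))).coeff (l * p) =
      if l = 1 then ((c + 2 : ℕ) : ZMod p) else 0 := by
    have e1 : (1 - X) * ((-(X - 1) ^ (p - 1)) ^ (0 + 1) * 1 ^ (c + 2 - (0 + 1)) *
        ((c + 2).choose (0 + 1) : (ZMod p)[X])) = C ((c + 2 : ℕ) : ZMod p) * (X ^ p - 1) := by
      have e3 : (X ^ p - 1 : (ZMod p)[X]) = (X - 1) * (X - 1) ^ (p - 1) := by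
        rw [← pow_succ', Nat.sub_add_cancel hp.one_le, sub_pow_char]; simp
      rw [e3]
      simp only [zero_add, Nat.choose_one_right, pow_one, one_pow, mul_one, map_natCast]
      ring
    have hlp : l * p ≠ 0 := by positivity
    rw [e1, coeff_C_mul, coeff_sub, coeff_X_pow, coeff_one, if_neg hlp]
    by_cases h : l = 1
    · simp [h]
    · have : l * p ≠ p := fun h' => h (Nat.eq_of_mul_eq_mul_right hp.pos (by omega))
      simp [h, this]
  have hlow0 : ((1 - X) * ((-(X - 1) ^ (p - 1)) ^ 0 * 1 ^ (c + 2 - 0) *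
        ((c + 2).choose 0 : (ZMod p)[X]))).coeff (l * p) = 0 := by
    have hlp : l * p ≠ 0 := by positivity
    have hlp1 : l * p ≠ 1 := fun h => by
      have := Nat.eq_one_of_mul_eq_one_left h
      omega
    simp [coeff_one, coeff_X, hlp, hlp1.symm]
  rw [hlow1, hlow0]
  split_ifs
  · push_cast; ring
  · simp

/-- For `l < p` the value `-1` is the coefficient of `x ^ (l p)` in `(1 - x) G(x ^ p)`; for `l = p`
and `l = p + 1` it comes from the quotient `Q` of `exists_mul_lineProd_pow`. -/
theorem coeff_one_sub_X_mul_lineProd_pow_of_gt {b l : ℕ} (hl : 2 * l = p + b) (hb1 : 1 ≤ b)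
    (hb : b ≤ p + 2) :
    ((1 - X) * lineProd (1 : ZMod p) p ^ (2 * l)).coeff (l * p) = -1 := by
  have hp := Fact.out (p := p.Prime)
  have hp1 := hp.one_lt
  obtain ⟨Q, h1, h2⟩ := exists_mul_lineProd_pow (1 : (ZMod p)[X]) b
  rw [mul_one] at h1 h2
  have hB1 : (1 - X : (ZMod p)[X]).natDegree ≤ 1 := by compute_degree
  have hA1 : ((1 - X) * lineProd (1 : ZMod p) p ^ b).natDegree ≤ 1 + b * (p - 1) :=
    natDegree_mul_le_of_le hB1 (natDegree_pow_le_of_le b (natDegree_lineProd_le _ _))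
  -- `Q` has no terms in degree `(l - 1) * p` or higher
  have hQ1 : Q.coeff (l * p - p) = 0 := by
    by_cases hQ : Q = 0
    · simp [hQ]
    have h3 := natDegree_add_le_of_mul_eq hp.ne_zero h1 hA1 (by omega) hQ
    apply coeff_eq_zero_of_natDegree_lt
    -- twice the difference of the two sides is `(p - 2) * (p + 2 - b) + 2`
    have h4 : 1 + b * (p - 1) < l * p := by
      obtain ⟨a, rfl⟩ : ∃ a, p = a + 2 := ⟨p - 2, by omega⟩
      rw [show a + 2 - 1 = a + 1 by omega]
      obtain ⟨c, hc⟩ : ∃ c, a + 4 = b + c := ⟨a + 4 - b, by omega⟩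
      zify at *
      nlinarith [mul_nonneg (Int.natCast_nonneg a) (Int.natCast_nonneg c)]
    omega
  have hXA : X ^ b ∣ (1 - X) * lineProd (1 : ZMod p) p ^ b :=
    (pow_dvd_pow_of_dvd X_dvd_lineProd_one b).mul_left _
  rw [X_pow_dvd_iff] at hXA
  have hQ0 : Q.coeff 0 = 1 := by
    have h3 := hXA 0 (by omega)
    rw [h1, coeff_add, sub_mul, coeff_sub, coeff_sub, coeff_X_pow_mul', if_neg (by omega)] at h3
    simp at h3
    linear_combination -h3
  rw [hl, h2, coeff_add, show l * p = l * p + 0 from rfl,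
    coeff_mul_expand _ _ (hB1.trans_lt hp1) hp.pos, add_zero, sub_mul, coeff_sub, coeff_sub,
    coeff_X_pow_mul', coeff_X_pow_mul', coeff_lineProd_one, hQ1, ite_self]
  simp only [coeff_one_zero, coeff_X_zero, sub_zero, one_mul]
  rcases lt_trichotomy l p with hlp | rfl | hlp
  · rw [if_pos (by omega), if_neg]
    · ring
    · rw [not_le]; exact Nat.mul_lt_mul_of_pos_right hlp hp.pos
  · rw [if_neg (by omega), if_pos le_rfl, Nat.sub_self, hQ0]
    ring
  · obtain rfl : l = p + 1 := by omega
    have h3 := hXA p (by omega)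
    rw [h1, coeff_add, sub_mul, coeff_sub, coeff_sub, coeff_X_pow_mul', if_pos le_rfl,
      Nat.sub_self, hQ0, coeff_one, if_neg hp.ne_zero, coeff_X, if_neg (by omega), one_mul] at h3
    rw [if_neg (by omega), if_pos (Nat.mul_le_mul_right p hlp.le),
      show (p + 1) * p - p * p = p by rw [add_mul, one_mul, Nat.add_sub_cancel_left]]
    linear_combination h3

theorem tableEntry_one_prime (hp2 : p ≠ 2) :
    tableEntry p 1 0 = 1 ∧ tableEntry p 1 1 = 1 ∧
      ∀ l : ℕ, 2 ≤ l → l ≤ p + 1 → tableEntry p 1 l = (p : ℤ) - 1 := by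
  have hp := Fact.out (p := p.Prime)
  have hp1 := hp.one_lt
  have hv : ∀ l : ℕ, (lineNumber (l * p + 1) : ZMod p) =
      ((1 - X) * lineProd (1 : ZMod p) p ^ (2 * l)).coeff (l * p) := fun l =>
    cast_lineNumber_of_neg_one ((even_two_mul l).mul_left p) (by ring)
  refine ⟨?_, ?_, fun l hl2 hl => ?_⟩
  · refine tableEntry_eq_of_cast zero_le_one (by exact_mod_cast hp1) ?_
    simp [lineNumber_one]
  · refine tableEntry_eq_of_cast zero_le_one (by exact_mod_cast hp1) ?_
    rw [hv, coeff_one_sub_X_mul_lineProd_pow_of_le hp2 le_rfl (by norm_num) (by norm_num)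
      (by omega)]
    norm_num
  · refine tableEntry_eq_of_cast (by omega) (by omega) ?_
    rw [hv]
    rcases le_or_gt (2 * l) (p + 1) with h | h
    · rw [coeff_one_sub_X_mul_lineProd_pow_of_le hp2 (by omega) (by omega) (by omega) h,
        if_neg (by omega)]
      simp
    · rw [coeff_one_sub_X_mul_lineProd_pow_of_gt (b := 2 * l - p) (by omega) (by omega) (by omega)]
      simp

/-- In the rows with `2 i = p + 3 + r`, the product consists of `2 l + 1` full periods and
`r + 1` further factors. -/
theorem exists_cast_lineNumber_eq_mul_coeff {i r : ℕ} (hi : 2 * i = p + 3 + r) (hr : r < p)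
    (l : ℕ) :
    ∃ c : ZMod p, (lineNumber (l * p + i) : ZMod p) =
      c * ((1 - X) * lineProd (r : ZMod p) (r + 1) *
        lineProd (1 : ZMod p) p ^ (2 * l + 1)).coeff (l * p + (i - 1)) := by
  have hd : 2 * ((l * p + i : ℕ) : ZMod p) - 3 = r := by
    have h3 : 2 * (l * p + i) = p * (2 * l + 1) + 3 + r := by rw [mul_add, hi]; ring
    have := congrArg (Nat.cast : ℕ → ZMod p) h3
    simp only [Nat.cast_add, Nat.cast_mul, CharP.cast_eq_zero, zero_mul, Nat.cast_ofNat] at this ⊢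
    rw [this]
    ring
  have hm : 2 * (l * p + i) - 2 = r + 1 + p * (2 * l + 1) := by
    rw [mul_add, hi]
    have : 2 * (l * p) + p = p * (2 * l + 1) := by ring
    omega
  rw [cast_lineNumber _ (by omega), hd, hm, lineProd_add_mul,
    show l * p + i - 1 = l * p + (i - 1) by omega]
  -- for `r = 0` the product contains the factor zero
  by_cases hr0 : (r : ZMod p) = 0
  · exact ⟨0, by rw [hr0, lineProd_zero_left (by omega)]; simp⟩
  · refine ⟨((r : ZMod p) ^ p) ^ (2 * l + 1), ?_⟩
    rw [lineProd_period (IsUnit.mk0 _ hr0), mul_pow, ← C_pow, mul_left_comm (lineProd _ _),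
      mul_left_comm, coeff_C_mul, mul_assoc]

/-- By `(1 - x) G = x ^ p - x`, the entry is a multiple of a coefficient of the remaining product,
in a degree exceeding that of this product. -/
theorem tableEntry_bottom_first_column {i r : ℕ} (hi : 2 * i = p + 3 + r) (hip : i ≤ p) :
    tableEntry p i 0 = 0 := by
  obtain ⟨c, hc⟩ := exists_cast_lineNumber_eq_mul_coeff hi (by omega) 0
  have hdeg := natDegree_lineProd_le (r : ZMod p) (r + 1)
  have hG := X_sub_one_mul_lineProd (p := p)
  have h : (1 - X) * lineProd (r : ZMod p) (r + 1) * lineProd (1 : ZMod p) p ^ (2 * 0 + 1) =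
      X ^ p * lineProd (r : ZMod p) (r + 1) - X * lineProd (r : ZMod p) (r + 1) := by
    linear_combination -lineProd (r : ZMod p) (r + 1) * hG
  obtain ⟨j, rfl⟩ : ∃ j, i = j + 2 := ⟨i - 2, by omega⟩
  rw [tableEntry_eq_zero_iff, hc, h, coeff_sub, coeff_X_pow_mul', if_neg (by omega),
    show 0 * p + (j + 2 - 1) = j + 1 by omega, coeff_X_mul,
    coeff_eq_zero_of_natDegree_lt (by omega)]
  simp

/-- With `B = (1 - x) F`, where `F` is the product of the `r + 1` remaining factors, the degree of `B`
is less than `i - 1`, so that only coefficients of the quotient `Q` of `exists_mul_lineProd_pow`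
could contribute. -/
theorem tableEntry_bottom_block {i r b l : ℕ} (hi : 2 * i = p + 3 + r) (hip : i ≤ p)
    (hl : 2 * l + 1 = p + b) (hlp : l ≤ p) :
    tableEntry p i l = 0 := by
  have hp := Fact.out (p := p.Prime)
  have hp1 := hp.one_lt
  obtain ⟨c, hc⟩ := exists_cast_lineNumber_eq_mul_coeff hi (by omega) l
  obtain ⟨Q, h1, h2⟩ := exists_mul_lineProd_pow (lineProd (r : ZMod p) (r + 1)) b
  have hB : ((1 - X) * lineProd (r : ZMod p) (r + 1)).natDegree ≤ 1 + r :=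
    natDegree_mul_le_of_le (by compute_degree) (natDegree_lineProd_le _ _)
  have hA : ((1 - X) * lineProd (r : ZMod p) (r + 1) * lineProd (1 : ZMod p) p ^ b).natDegree ≤
      1 + r + b * (p - 1) :=
    natDegree_mul_le_of_le hB (natDegree_pow_le_of_le b (natDegree_lineProd_le _ _))
  have hBi : ((1 - X) * lineProd (r : ZMod p) (r + 1)).coeff (i - 1) = 0 :=
    coeff_eq_zero_of_natDegree_lt (by omega)
  -- `Q` has no terms in degree `(l - 1) * p + i - 1` or higher
  have hQ1 : Q.coeff (l * p + (i - 1) - p) = 0 := by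
    by_cases hQ : Q = 0
    · simp [hQ]
    have h3 := natDegree_add_le_of_mul_eq hp.ne_zero h1 hA (by omega) hQ
    apply coeff_eq_zero_of_natDegree_lt
    -- twice the difference of the two sides is `(p - 2) * (p + 1 - b) + (p + 1 - r)`
    have h4 : 1 + r + b * (p - 1) < l * p + (i - 1) := by
      obtain ⟨a, rfl⟩ : ∃ a, p = a + 2 := ⟨p - 2, by omega⟩
      obtain ⟨j, rfl⟩ : ∃ j, i = j + 1 := ⟨i - 1, by omega⟩
      rw [show a + 2 - 1 = a + 1 by omega, Nat.add_sub_cancel]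
      obtain ⟨c, hc⟩ : ∃ c, a + 3 = b + c := ⟨a + 3 - b, by omega⟩
      zify at *
      nlinarith [mul_nonneg (Int.natCast_nonneg a) (Int.natCast_nonneg c)]
    omega
  rw [tableEntry_eq_zero_iff, hc, hl, h2, coeff_add,
    coeff_mul_expand _ _ (by omega) (by omega), hBi, sub_mul, coeff_sub,
    coeff_X_pow_mul', coeff_X_pow_mul', hQ1, ite_self]
  split_ifs with h
  · obtain rfl : l = p := by
      refine le_antisymm hlp (Nat.le_of_lt_succ (Nat.lt_of_mul_lt_mul_right (a := p) ?_))
      rw [Nat.succ_mul]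
      omega
    -- comparing coefficients at `x ^ (i - 1)`, where `b = p + 1 > i - 1`, gives `Q.coeff (i - 1) = 0`
    have hXA : X ^ b ∣ (1 - X) * lineProd (r : ZMod l) (r + 1) * lineProd (1 : ZMod l) l ^ b :=
      (pow_dvd_pow_of_dvd X_dvd_lineProd_one b).mul_left _
    have h3 := X_pow_dvd_iff.1 hXA (i - 1) (by omega)
    rw [h1, coeff_add, hBi, sub_mul, coeff_sub, coeff_X_pow_mul', if_neg (by omega), one_mul] at h3
    rw [Nat.add_sub_cancel_left]
    linear_combination c * h3
  · simp

end PrimeTables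

/-! ### The product modulo powers of two -/

section PowersOfTwo

open Polynomial

theorem dvd_prod_sub_prod {ι R : Type*} [CommRing R] (s : Finset ι) {k : R} {f g : ι → R}
    (h : ∀ i ∈ s, k ∣ f i - g i) : k ∣ ∏ i ∈ s, f i - ∏ i ∈ s, g i := by
  classical
  induction s using Finset.induction_on with
  | empty => simp
  | insert a s ha ih =>
    rw [Finset.prod_insert ha, Finset.prod_insert ha]
    exact dvd_mul_sub_mul (h a (Finset.mem_insert_self a s))
      (ih fun i hi => h i (Finset.mem_insert_of_mem hi))

/-- For odd `d`, two consecutive factors multiply to `x` modulo 2. -/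
theorem two_dvd_lineProd_sub {R : Type*} [CommRing R] {d : R} (hd : Odd d) (n : ℕ) :
    (2 : R[X]) ∣ lineProd d (2 * n) - X ^ n := by
  obtain ⟨e, rfl⟩ := hd
  induction n with
  | zero => simp [lineProd]
  | succ n ih =>
    rw [mul_add, mul_one, ← Nat.add_assoc (2 * n) 1 1, lineProd_succ, lineProd_succ, pow_succ,
      mul_assoc]
    refine dvd_mul_sub_mul ih ?_
    simp only [map_add, map_mul, map_one, map_natCast, Nat.cast_add, Nat.cast_mul, Nat.cast_ofNat,
      Nat.cast_one, C_ofNat]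
    exact ⟨2 * C e ^ 2 + 2 * C e + 2 * (n : R[X]) * (X - 1) + C e * (4 * (n : R[X]) + 1) * (X - 1) +
      (n : R[X]) * (2 * (n : R[X]) + 1) * (X - 1) ^ 2, by ring⟩

theorem odd_lineNumber (n : ℕ) : Odd (lineNumber n) := by
  rcases n with _ | n
  · rw [lineNumber_zero]; decide
  · obtain ⟨E, hE⟩ := two_dvd_lineProd_sub (R := ℤ) (d := 2 * ((n + 1 : ℕ) : ℤ) - 3)
      ⟨(n : ℤ) - 1, by push_cast; ring⟩ n
    have hE' : (1 - X) * lineProd (2 * ((n + 1 : ℕ) : ℤ) - 3) (2 * n) =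
        X ^ n - X ^ (n + 1) + C 2 * ((1 - X) * E) := by
      rw [C_ofNat]
      linear_combination (1 - X) * hE
    rw [lineNumber_eq_coeff (n := n + 1) (by omega), show 2 * (n + 1) - 2 = 2 * n by omega, hE',
      Nat.add_sub_cancel, coeff_add, coeff_sub, coeff_X_pow_self, coeff_X_pow, if_neg (by omega),
      coeff_C_mul]
    exact ⟨_, by rw [sub_zero, add_comm]⟩

/-- The second half of the product is congruent to the first one modulo `4 h`; to see this, the
factors with indices `j` and `j + h` are multiplied. -/
theorem dvd_lineProd_four_mul_sub_sq {h : ℕ} (hh : Even h) :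
    C (4 * h : ℤ) ∣ lineProd (1 : ℤ) (4 * h) - lineProd (1 : ℤ) (2 * h) ^ 2 := by
  obtain ⟨g, rfl⟩ := hh.two_dvd
  rw [lineProd, show 4 * (2 * g) = 2 * (2 * g) + 2 * (2 * g) by ring, Finset.prod_range_add, sq,
    lineProd]
  refine dvd_mul_sub_mul (by simp) ?_
  rw [two_mul (2 * g), Finset.prod_range_add, Finset.prod_range_add, ← Finset.prod_mul_distrib,
    ← Finset.prod_mul_distrib]
  refine dvd_prod_sub_prod _ fun j _ => ?_
  simp only [Nat.cast_add, Nat.cast_mul, Nat.cast_ofNat, map_add, map_mul, map_one, map_natCast,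
    C_ofNat]
  exact ⟨(X - 1) * (1 + (j : ℤ[X]) * (X - 1)) + 3 * (g : ℤ[X]) * (X - 1) ^ 2, by ring⟩

/-- The product over a full period modulo `2 ^ q`, for `q ≥ 3`: the induction step is squaring. -/
theorem exists_lineProd_two_pow (s : ℕ) : ∃ (N : ℕ) (R : ℤ[X]), 2 ^ (s + 2) = N + 2 ∧
    lineProd (1 : ℤ) (2 ^ (s + 3)) =
      X ^ (N + 2) + 2 ^ (s + 2) * (X ^ (N + 1) + X ^ (N + 3) + (X ^ N + X ^ (N + 4))) +
        2 ^ (s + 3) * R := by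
  induction s with
  | zero =>
    refine ⟨2, 90 * X - 761 * X ^ 2 + 2655 * X ^ 3 - 4909 * X ^ 4 +
      5070 * X ^ 5 - 2777 * X ^ 6 + 630 * X ^ 7,
      rfl, ?_⟩
    norm_num [lineProd, Finset.prod_range_succ]
    ring
  | succ s ih =>
    obtain ⟨N, R, hN, hR⟩ := ih
    obtain ⟨T, hT⟩ := dvd_lineProd_four_mul_sub_sq (h := 2 ^ (s + 2))
      ⟨2 ^ (s + 1), by ring⟩
    have h4 : 4 * 2 ^ (s + 2) = 2 ^ (s + 1 + 3) := by ring
    have h2 : 2 * 2 ^ (s + 2) = 2 ^ (s + 3) := by ring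
    rw [h4, h2, hR] at hT
    refine ⟨N + (N + 2), X ^ (N + 2) * R + 2 ^ s *
      (X ^ (N + 1) + X ^ (N + 3) + (X ^ N + X ^ (N + 4)) + 2 * R) ^ 2 + T, ?_, ?_⟩
    · rw [show s + 1 + 2 = s + 2 + 1 by ring, pow_succ, hN]; ring
    · rw [eq_add_of_sub_eq hT]
      simp only [map_mul, map_pow, Nat.cast_pow, Nat.cast_ofNat, C_ofNat]
      ring

theorem two_pow_zmod_eq_zero (q : ℕ) : (2 : ZMod (2 ^ q)) ^ q = 0 := by
  exact_mod_cast ZMod.natCast_self (2 ^ q)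

/-- The product over a full period modulo `2 ^ q`, for `q ≥ 2`. -/
theorem exists_lineProd_zmod_two_pow (s : ℕ) : ∃ (N : ℕ) (e : ZMod (2 ^ (s + 2))),
    2 ^ (s + 1) = N + 2 ∧
    lineProd (1 : ZMod (2 ^ (s + 2))) (2 ^ (s + 2)) =
      X ^ (N + 2) + C (2 ^ (s + 1)) * (X ^ (N + 1) + X ^ (N + 3) + C e * (X ^ N + X ^ (N + 4))) := by
  have key : ∃ (N : ℕ) (e : ℤ) (R : ℤ[X]), 2 ^ (s + 1) = N + 2 ∧
      lineProd (1 : ℤ) (2 ^ (s + 2)) =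
      X ^ (N + 2) + 2 ^ (s + 1) * (X ^ (N + 1) + X ^ (N + 3) + C e * (X ^ N + X ^ (N + 4))) +
        2 ^ (s + 2) * R := by
    rcases s with _ | s
    · refine ⟨0, 0, X ^ 3 - 2 * X ^ 2, rfl, ?_⟩
      norm_num [lineProd, Finset.prod_range_succ]
      ring
    · obtain ⟨N, R, hN, hR⟩ := exists_lineProd_two_pow s
      exact ⟨N, 1, R, hN, by rw [hR, map_one, one_mul]⟩
  obtain ⟨N, e, R, hN, hR⟩ := key
  refine ⟨N, e, hN, ?_⟩
  have h := congrArg (Polynomial.map (Int.castRingHom (ZMod (2 ^ (s + 2))))) hR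
  rw [map_lineProd] at h
  have h0 : (2 : (ZMod (2 ^ (s + 2)))[X]) ^ (s + 2) = 0 := by
    rw [← C_ofNat, ← C_pow, two_pow_zmod_eq_zero, C_0]
  simpa [h0, C_ofNat] using h

theorem lineProd_two_pow_of_odd {q : ℕ} (hq : q ≠ 0) {d : ZMod (2 ^ q)} (hd : Odd d) :
    lineProd d (2 ^ q) = lineProd 1 (2 ^ q) := by
  have h2 : IsNilpotent (2 : ZMod (2 ^ q)) := ⟨q, two_pow_zmod_eq_zero q⟩
  obtain ⟨e, he⟩ := hd
  -- `2` is nilpotent, so that `d` is a unit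
  have hu : IsUnit d := by
    rw [he]
    exact ((Commute.all 2 e).isNilpotent_mul_right h2).isUnit_add_one
  rw [lineProd_period hu]
  obtain ⟨u, rfl⟩ := hu
  obtain ⟨r, rfl⟩ := Nat.exists_eq_succ_of_ne_zero hq
  have h := ZMod.pow_totient u
  rw [Nat.totient_prime_pow_succ Nat.prime_two] at h
  have h' := congrArg Units.val (congrArg (· ^ 2) h)
  simp only [Nat.add_one_sub_one, mul_one, ← pow_mul, one_pow, ← pow_succ, Units.val_pow_eq_pow_val,
    Units.val_one] at h'
  rw [h', map_one, one_mul]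

/-- Dividing by `1 + 2 x`, starting from the lowest term. -/
theorem coeff_of_two_X_add_one_mul {R : Type*} [CommRing R] {g P : R[X]}
    (h : (2 * X + 1) * g = P) {m : ℕ} (hP : ∀ j < m, P.coeff j = 0) :
    ∀ j ≤ m, g.coeff j = P.coeff j := by
  intro j
  induction j with
  | zero =>
    intro _
    rw [← h, add_mul, mul_assoc, ← C_ofNat, coeff_add, coeff_C_mul]
    simp
  | succ j ih =>
    intro hj
    have h1 := ih (by omega)
    rw [hP j (by omega)] at h1
    rw [← h, add_mul, mul_assoc, ← C_ofNat, coeff_add, coeff_C_mul, coeff_X_mul, h1]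
    simp

theorem coeff_succ_of_two_X_add_one_mul {R : Type*} [CommRing R] {g P : R[X]}
    (h : (2 * X + 1) * g = P) (j : ℕ) : g.coeff (j + 1) = P.coeff (j + 1) - 2 * g.coeff j := by
  rw [← h, add_mul, mul_assoc, ← C_ofNat, coeff_add, coeff_C_mul, coeff_X_mul, one_mul]
  ring

theorem coeff_of_X_add_two_mul {R : Type*} [CommRing R] {g P : R[X]}
    (h : (X + 2) * g = P) (j : ℕ) : g.coeff j = P.coeff (j + 1) - 2 * g.coeff (j + 1) := by
  rw [← h, add_mul, ← C_ofNat, coeff_add, coeff_C_mul, coeff_X_mul]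
  ring

/-- Dividing by `x + 2`, where `2` is nilpotent, starting from the highest term. -/
theorem coeff_eq_zero_of_X_add_two_mul {R : Type*} [CommRing R] {g P : R[X]}
    (h2 : IsNilpotent (2 : R)) (h : (X + 2) * g = P) {m : ℕ} (hP : ∀ j > m, P.coeff j = 0) {j : ℕ}
    (hj : m ≤ j) : g.coeff j = 0 := by
  have key : ∀ t, g.coeff j = (-2) ^ t * g.coeff (j + t) := by
    intro t
    induction t with
    | zero => simp
    | succ t ih =>
      rw [ih, coeff_of_X_add_two_mul h, hP _ (by omega), add_assoc]
      ring
  obtain ⟨q, hq⟩ := h2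
  rw [key q, neg_pow, hq]
  simp

/-- The case `n = 0` of the congruence `v_{n + 2 ^ (q - 1)} ≡ v_n + 2 ^ (q - 1)`: here the product
`f` misses only the factors `-(2 x + 1)` and `-(x + 2)` of a full period. The coefficient wanted is
the difference of coefficients of `(x + 2) f` and `(2 x + 1) f`. -/
theorem cast_lineNumber_two_pow (s : ℕ) :
    (lineNumber (2 ^ (s + 1)) : ZMod (2 ^ (s + 2))) = 2 ^ (s + 1) - 1 := by
  obtain ⟨N, e, hN, hP⟩ := exists_lineProd_zmod_two_pow s
  have h0 := two_pow_zmod_eq_zero (s + 2)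
  have hq : 2 ^ (s + 2) = 2 * N + 2 + 1 + 1 := by rw [pow_succ, hN]; ring
  have hNc : (2 * N + 4 : ZMod (2 ^ (s + 2))) = 0 := by
    have := congrArg (Nat.cast : ℕ → ZMod (2 ^ (s + 2))) hq
    push_cast at this
    rw [h0] at this
    linear_combination -this
  have hNX : (2 * N + 4 : (ZMod (2 ^ (s + 2)))[X]) = 0 := by
    have := congrArg (C : ZMod (2 ^ (s + 2)) → _) hNc
    simpa [C_ofNat] using this
  rw [← lineProd_two_pow_of_odd (d := -3) (by omega) ⟨-2, by norm_num⟩] at hP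
  have hd : 2 * ((N + 2 : ℕ) : ZMod (2 ^ (s + 2))) - 3 = -3 := by
    push_cast
    linear_combination hNc
  rw [hN, cast_lineNumber _ (by omega), hd, show 2 * (N + 2) - 2 = 2 * N + 2 by omega,
    show N + 2 - 1 = N + 1 by omega]
  set f := lineProd (-3 : ZMod (2 ^ (s + 2))) (2 * N + 2) with hf
  have hfP : (2 * X + 1) * ((X + 2) * f) = lineProd (-3 : ZMod (2 ^ (s + 2))) (2 ^ (s + 2)) := by
    have : ∀ m, m = 2 * N + 2 + 1 + 1 → lineProd (-3 : ZMod (2 ^ (s + 2))) m =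
        (2 * X + 1) * ((X + 2) * f) := by
      rintro m rfl
      rw [lineProd_succ, lineProd_succ, ← hf]
      simp only [map_neg, C_ofNat, map_natCast]
      push_cast
      linear_combination 
        (f * (X - 1) * ((2 * (N : (ZMod (2 ^ (s + 2)))[X]) + 1) * (X - 1) - 6)) * hNX
    exact (this _ hq).symm
  rw [hP] at hfP
  have hfP' : (X + 2) * ((2 * X + 1) * f) = _ := (mul_left_comm _ _ _).trans hfP
  set P : (ZMod (2 ^ (s + 2)))[X] := X ^ (N + 2) +
    C (2 ^ (s + 1)) * (X ^ (N + 1) + X ^ (N + 3) + C e * (X ^ N + X ^ (N + 4))) with hPdef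
  have hPc : ∀ j, P.coeff j = (if j = N + 2 then 1 else 0) + 2 ^ (s + 1) *
      ((if j = N + 1 then 1 else 0) + (if j = N + 3 then 1 else 0) +
        e * ((if j = N then 1 else 0) + (if j = N + 4 then 1 else 0))) := by
    intro j
    simp only [hPdef, coeff_add, coeff_C_mul, coeff_X_pow]
  have h2h : (2 : ZMod (2 ^ (s + 2))) * 2 ^ (s + 1) = 0 := by rw [← pow_succ', h0]
  have hg : ((X + 2) * f).coeff (N + 1) = 2 ^ (s + 1) := by
    have hlow : ∀ j < N, P.coeff j = 0 := by
      intro j hj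
      rw [hPc, if_neg (by omega), if_neg (by omega), if_neg (by omega), if_neg (by omega),
        if_neg (by omega)]
      ring
    rw [coeff_succ_of_two_X_add_one_mul hfP, coeff_of_two_X_add_one_mul hfP hlow N le_rfl, hPc, hPc]
    simp
    linear_combination e * h2h
  have hg' : ((2 * X + 1) * f).coeff (N + 1) = 1 := by
    have hhigh : ∀ j > N + 4, P.coeff j = 0 := by
      intro j hj
      rw [hPc, if_neg (by omega), if_neg (by omega), if_neg (by omega), if_neg (by omega),
        if_neg (by omega)]
      ring
    have c2 : P.coeff (N + 2) = 1 := by rw [hPc]; simp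
    have c3 : P.coeff (N + 3) = 2 ^ (s + 1) := by rw [hPc]; simp
    have c4 : P.coeff (N + 4) = 2 ^ (s + 1) * e := by rw [hPc]; simp
    have a1 : _ = P.coeff (N + 2) - _ := coeff_of_X_add_two_mul hfP' (N + 1)
    have a2 : _ = P.coeff (N + 3) - _ := coeff_of_X_add_two_mul hfP' (N + 2)
    have a3 : _ = P.coeff (N + 4) - _ := coeff_of_X_add_two_mul hfP' (N + 3)
    have a4 := coeff_eq_zero_of_X_add_two_mul ⟨_, h0⟩ hfP' hhigh le_rfl
    rw [a1, a2, a3, a4, c2, c3, c4]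
    linear_combination (2 * e - 1) * h2h
  rw [add_mul, ← C_ofNat, coeff_add, coeff_C_mul, coeff_X_mul] at hg
  rw [add_mul, mul_assoc, ← C_ofNat, coeff_add, coeff_C_mul, coeff_X_mul, one_mul] at hg'
  rw [sub_mul, one_mul, coeff_sub, coeff_X_mul]
  linear_combination hg - hg'

/-- Passing from `n` to `n + 2 ^ (s + 1)` multiplies the product by a full period; in its terms
divisible by `2 ^ (s + 1)`, the product for `n` may be replaced by `x ^ (n - 1)`. -/
theorem cast_lineNumber_add_two_pow (n s : ℕ) :
    (lineNumber (n + 2 ^ (s + 1)) : ZMod (2 ^ (s + 2))) = lineNumber n + 2 ^ (s + 1) := by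
  rcases n with _ | n
  · rw [zero_add, cast_lineNumber_two_pow, lineNumber_zero]
    push_cast
    ring
  obtain ⟨N, e, hN, hP⟩ := exists_lineProd_zmod_two_pow s
  have h0 := two_pow_zmod_eq_zero (s + 2)
  have hodd : Odd (2 * ((n + 1 : ℕ) : ZMod (2 ^ (s + 2))) - 3) :=
    ⟨(n : ZMod (2 ^ (s + 2))) - 1, by push_cast; ring⟩
  have hd : 2 * ((n + 1 + 2 ^ (s + 1) : ℕ) : ZMod (2 ^ (s + 2))) - 3 =
      2 * ((n + 1 : ℕ) : ZMod (2 ^ (s + 2))) - 3 := by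
    push_cast
    linear_combination h0
  have hm : 2 * (n + 1 + 2 ^ (s + 1)) - 2 = 2 * n + 2 ^ (s + 2) * 1 := by
    rw [pow_succ 2 (s + 1)]; omega
  rw [cast_lineNumber _ (by omega), cast_lineNumber _ (by omega), hd, hm, lineProd_add_mul,
    pow_one, lineProd_two_pow_of_odd (by omega) hodd, hP,
    show 2 * (n + 1) - 2 = 2 * n by omega, show n + 1 + 2 ^ (s + 1) - 1 = n + (N + 2) by omega,
    Nat.add_sub_cancel]
  obtain ⟨E, hE⟩ := two_dvd_lineProd_sub hodd n
  set f := lineProd (2 * ((n + 1 : ℕ) : ZMod (2 ^ (s + 2))) - 3) (2 * n)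
  have h2 : C (2 ^ (s + 1) : ZMod (2 ^ (s + 2))) * 2 = 0 := by
    rw [← C_ofNat, ← C_mul, ← pow_succ, h0, C_0]
  have hexp : (1 - X) * (f * (X ^ (N + 2) + C (2 ^ (s + 1)) *
      (X ^ (N + 1) + X ^ (N + 3) + C e * (X ^ N + X ^ (N + 4))))) =
      (1 - X) * f * X ^ (N + 2) + C (2 ^ (s + 1)) * (X ^ (n + N + 1) - X ^ (n + N + 2) +
        X ^ (n + N + 3) - X ^ (n + N + 4) + C e * (X ^ (n + N) - X ^ (n + N + 1) +
        X ^ (n + N + 4) - X ^ (n + N + 5))) := by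
    linear_combination ((1 - X) * C (2 ^ (s + 1)) *
      (X ^ (N + 1) + X ^ (N + 3) + C e * (X ^ N + X ^ (N + 4)))) * hE + E * ((1 - X) *
      (X ^ (N + 1) + X ^ (N + 3) + C e * (X ^ N + X ^ (N + 4)))) * h2
  rw [hexp, coeff_add, coeff_mul_X_pow, coeff_C_mul]
  simp [coeff_X_pow, add_assoc]
  linear_combination -h0

theorem lineNumber_add_two_pow_modEq (n s : ℕ) :
    lineNumber (n + 2 ^ (s + 1)) ≡ lineNumber n + 2 ^ (s + 1) [ZMOD 2 ^ (s + 2)] := by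
  have h := cast_lineNumber_add_two_pow n s
  have h' : ((lineNumber (n + 2 ^ (s + 1)) : ℤ) : ZMod (2 ^ (s + 2))) =
      ((lineNumber n + 2 ^ (s + 1) : ℤ) : ZMod (2 ^ (s + 2))) := by
    push_cast
    exact h
  simpa using (ZMod.intCast_eq_intCast_iff _ _ _).1 h'

end PowersOfTwo

/-! ### Tables modulo powers of two -/

section PowerOfTwoTables

theorem lineNumber_add_mul_two_pow_modEq {q : ℕ} (hq : 1 ≤ q) (i l : ℕ) :
    lineNumber (l * 2 ^ q + i) ≡ lineNumber i [ZMOD 2 ^ q] := by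
  obtain ⟨s, rfl⟩ : ∃ s, q = s + 1 := ⟨q - 1, by omega⟩
  induction l with
  | zero => simp
  | succ l ih =>
    -- a shift by `2 ^ q` adds `2 ^ q` modulo `2 ^ (q + 1)`
    have h := (lineNumber_add_two_pow_modEq (l * 2 ^ (s + 1) + i) s).of_dvd
      (pow_dvd_pow 2 (Nat.le_succ (s + 1)))
    rw [show (l + 1) * 2 ^ (s + 1) + i = l * 2 ^ (s + 1) + i + 2 ^ (s + 1) by ring]
    exact (h.trans (by simp)).trans ih

theorem tableEntry_two_pow {q : ℕ} (hq : 1 ≤ q) (i l : ℕ) :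
    tableEntry (2 ^ q) i l = lineNumber i % 2 ^ q := by
  rw [tableEntry]
  push_cast
  exact lineNumber_add_mul_two_pow_modEq hq i l

/-- Every odd residue class modulo `2 ^ q` is taken twice by `v_1, …, v_{2 ^ q}`. Modulo
`2 ^ (q + 1)`, the indices `j` and `j + 2 ^ q` have as their values the two lifts of the residue
of `v_j` modulo `2 ^ q`, in some order. -/
theorem card_filter_lineNumber_modEq {q : ℕ} (hq : 1 ≤ q) {a : ℤ} (ha : Odd a) :
    ((Finset.range (2 ^ q)).filter fun j => lineNumber (j + 1) ≡ a [ZMOD 2 ^ q]).card = 2 := by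
  induction q, hq using Nat.le_induction with
  | base =>
    rw [Finset.filter_true_of_mem, Finset.card_range, pow_one]
    intro j _
    rw [pow_one]
    exact (Int.odd_iff.1 (odd_lineNumber _)).trans (Int.odd_iff.1 ha).symm
  | succ q hq ih =>
    rw [Finset.card_filter] at ih ⊢
    rw [pow_succ, mul_two, Finset.sum_range_add, ← Finset.sum_add_distrib]
    refine Eq.trans (Finset.sum_congr rfl fun j _ => ?_) ih
    obtain ⟨s, rfl⟩ : ∃ s, q = s + 1 := ⟨q - 1, by omega⟩
    have h := lineNumber_add_two_pow_modEq (j + 1) s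
    rw [show 2 ^ (s + 1) + j + 1 = j + 1 + 2 ^ (s + 1) by ring]
    have h2 : (2 : ℤ) ^ (s + 1 + 1) = 2 * 2 ^ (s + 1) := pow_succ' 2 (s + 1)
    rw [h2] at h ⊢
    have hpos : (0 : ℤ) < 2 ^ (s + 1) := by positivity
    generalize (2 : ℤ) ^ (s + 1) = M at h hpos ⊢
    generalize lineNumber (j + 1) = v at h ⊢
    generalize lineNumber (j + 1 + 2 ^ (s + 1)) = w at h ⊢
    have hw : w ≡ a [ZMOD 2 * M] ↔ v + M ≡ a [ZMOD 2 * M] :=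
      ⟨fun h' => h.symm.trans h', fun h' => h.trans h'⟩
    simp only [hw, Int.modEq_iff_dvd]
    by_cases hv : M ∣ a - v
    · rw [if_pos hv]
      obtain ⟨c, hc⟩ := hv
      have h3 : 2 * M ∣ a - v ↔ 2 ∣ c := by
        rw [hc, mul_comm 2 M]; exact mul_dvd_mul_iff_left hpos.ne'
      have h4 : 2 * M ∣ a - (v + M) ↔ 2 ∣ c - 1 := by
        rw [show a - (v + M) = M * (c - 1) by linear_combination hc, mul_comm 2 M]
        exact mul_dvd_mul_iff_left hpos.ne'
      simp only [h3, h4]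
      rcases Int.even_or_odd' c with ⟨d, rfl | rfl⟩
      · rw [if_pos (by omega), if_neg (by omega)]
      · rw [if_neg (by omega), if_pos (by omega)]
    · rw [if_neg hv, if_neg, if_neg]
      · intro h'
        have h5 := (dvd_trans (dvd_mul_left M 2) h').add (dvd_refl M)
        exact hv (by rwa [show a - (v + M) + M = a - v by ring] at h5)
      · exact fun h' => hv (dvd_trans (dvd_mul_left M 2) h')

theorem ncard_constant_rows {q : ℕ} (hq : 1 ≤ q) {a : ℤ} (ha : Odd a) (h1 : 1 ≤ a)
    (h2 : a ≤ 2 ^ q) :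
    {i : ℕ | 1 ≤ i ∧ i ≤ 2 ^ q ∧ ∀ l : ℕ, tableEntry (2 ^ q) i l = a}.ncard = 2 := by
  have hlt : a < 2 ^ q := by
    refine lt_of_le_of_ne h2 ?_
    rintro rfl
    exact absurd ha (by simp [Int.even_pow]; omega)
  have hset : {i : ℕ | 1 ≤ i ∧ i ≤ 2 ^ q ∧ ∀ l : ℕ, tableEntry (2 ^ q) i l = a} =
      ((((Finset.range (2 ^ q)).filter fun j => lineNumber (j + 1) ≡ a [ZMOD 2 ^ q]).map
        (addRightEmbedding 1) : Finset ℕ) : Set ℕ) := by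
    ext i
    simp only [tableEntry_two_pow hq, forall_const, Set.mem_ofPred_eq, Finset.coe_map,
      Finset.coe_filter, Finset.mem_range, Set.mem_image, addRightEmbedding_apply, Int.ModEq,
      Int.emod_eq_of_lt (by omega : 0 ≤ a) hlt]
    constructor
    · rintro ⟨hi1, hi2, h⟩
      exact ⟨i - 1, ⟨by omega, by rwa [Nat.sub_add_cancel hi1]⟩, by omega⟩
    · rintro ⟨j, ⟨hj, h⟩, rfl⟩
      exact ⟨by omega, by omega, h⟩
  rw [hset, Set.ncard_coe_finset, Finset.card_map, card_filter_lineNumber_modEq hq ha]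

theorem tableEntry_two_pow_of_modEq {q i : ℕ} (hq : 1 ≤ q) {a : ℤ} (h0 : 0 ≤ a) (hlt : a < 2 ^ q)
    (h : lineNumber i ≡ a [ZMOD 2 ^ q]) (l : ℕ) : tableEntry (2 ^ q) i l = a := by
  rw [tableEntry_two_pow hq, h, Int.emod_eq_of_lt h0 hlt]

theorem lineNumber_two : lineNumber 2 = 1 := by
  open Polynomial in
  have h : lineProd (1 : ℤ) 2 = X := by
    rw [lineProd_succ, lineProd_succ]
    simp [lineProd]
  rw [lineNumber_eq_coeff two_ne_zero]
  norm_num [h, sub_mul]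

theorem tableEntry_two_pow_special_rows {q : ℕ} (hq : 2 ≤ q) (l : ℕ) :
    tableEntry (2 ^ q) 1 l = 1 ∧
    tableEntry (2 ^ q) 2 l = 1 ∧
    tableEntry (2 ^ q) (2 ^ (q - 1)) l = 2 ^ (q - 1) - 1 ∧
    tableEntry (2 ^ q) (2 ^ (q - 1) + 1) l = 2 ^ (q - 1) + 1 ∧
    tableEntry (2 ^ q) (2 ^ (q - 1) + 2) l = 2 ^ (q - 1) + 1 ∧
    tableEntry (2 ^ q) (2 ^ q) l = 2 ^ q - 1 := by
  obtain ⟨s, rfl⟩ : ∃ s, q = s + 2 := ⟨q - 2, by omega⟩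
  have hM : (2 : ℤ) ^ (s + 2) = 2 * 2 ^ (s + 1) := pow_succ' 2 (s + 1)
  have hM2 : (2 : ℤ) ≤ 2 ^ (s + 1) := by
    rw [pow_succ]
    have : (1 : ℤ) ≤ 2 ^ s := one_le_pow₀ one_le_two
    omega
  have hq1 : 1 ≤ s + 2 := by omega
  have h := fun n => lineNumber_add_two_pow_modEq n s
  rw [show s + 2 - 1 = s + 1 by omega]
  refine ⟨?_, ?_, ?_, ?_, ?_, ?_⟩
  · refine tableEntry_two_pow_of_modEq hq1 (by omega) (by omega) ?_ l
    rw [lineNumber_one]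
  · refine tableEntry_two_pow_of_modEq hq1 (by omega) (by omega) ?_ l
    rw [lineNumber_two]
  · refine tableEntry_two_pow_of_modEq hq1 (by omega) (by omega) ?_ l
    have := h 0
    rwa [zero_add, lineNumber_zero, neg_add_eq_sub] at this
  · refine tableEntry_two_pow_of_modEq hq1 (by omega) (by omega) ?_ l
    have := h 1
    rwa [lineNumber_one, add_comm 1, add_comm (1 : ℤ)] at this
  · refine tableEntry_two_pow_of_modEq hq1 (by omega) (by omega) ?_ l
    have := h 2
    rwa [lineNumber_two, add_comm 2, add_comm (1 : ℤ)] at this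
  · refine tableEntry_two_pow_of_modEq hq1 (by omega) (by omega) ?_ l
    have := lineNumber_add_mul_two_pow_modEq hq1 0 1
    rw [lineNumber_zero, one_mul, add_zero] at this
    exact this.trans (by simp [Int.modEq_iff_dvd])

theorem tableEntry_two_pow_half_shift {q : ℕ} (hq : 2 ≤ q) (i l : ℕ) :
    tableEntry (2 ^ q) (i + 2 ^ (q - 1)) l ≡
      tableEntry (2 ^ q) i l + 2 ^ (q - 1) [ZMOD 2 ^ q] := by
  obtain ⟨s, rfl⟩ : ∃ s, q = s + 2 := ⟨q - 2, by omega⟩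
  rw [tableEntry_two_pow (by omega), tableEntry_two_pow (by omega)]
  exact (Int.mod_modEq _ _).trans ((lineNumber_add_two_pow_modEq i s).trans
    ((Int.mod_modEq _ _).symm.add_right _))

end PowerOfTwoTables

theorem mainTheorem1 :
    -- 1. all `v_n` are odd
    (∀ n : ℕ, Odd (lineNumber n)) ∧
    -- 2. the first two rows of each table are equal
    (∀ k : ℕ, 1 ≤ k → ∀ l : ℕ, tableEntry k 1 l = tableEntry k 2 l) ∧
    -- 3. for even `k`, rows `k/2 + 1` and `k/2 + 2` are equal
    (∀ k : ℕ, 1 ≤ k → Even k →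
      ∀ l : ℕ, tableEntry k (k / 2 + 1) l = tableEntry k (k / 2 + 2) l) ∧
    -- 4. for odd `k`, row `(k + 3)/2` is zero
    (∀ k : ℕ, Odd k → ∀ l : ℕ, tableEntry k ((k + 3) / 2) l = 0) ∧
    -- 5. for prime `k`, the first two rows start with `1, 1`, then `k` times `k - 1`
    (∀ k : ℕ, k.Prime → ∀ i : ℕ, i = 1 ∨ i = 2 →
      tableEntry k i 0 = 1 ∧ tableEntry k i 1 = 1 ∧
      ∀ l : ℕ, 2 ≤ l → l ≤ k + 1 → tableEntry k i l = (k : ℤ) - 1) ∧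
    -- 6. for prime `k > 2`, the last `(k - 1)/2` slots of the first column vanish
    (∀ k : ℕ, k.Prime → 2 < k →
      ∀ i : ℕ, (k + 3) / 2 ≤ i → i ≤ k → tableEntry k i 0 = 0) ∧
    -- 7. for prime `k > 2`, after `(k - 1)/2` columns there is a block of zeros at the bottom,
    -- of height `(k - 1)/2` and width `(k + 3)/2`
    (∀ k : ℕ, k.Prime → 2 < k →
      ∀ i : ℕ, (k + 3) / 2 ≤ i → i ≤ k →
      ∀ l : ℕ, (k - 1) / 2 ≤ l → l < (k - 1) / 2 + (k + 3) / 2 → tableEntry k i l = 0) ∧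
    -- 8. for `k = 2 ^ q`, all rows are constant, and every odd residue `a` fills exactly two rows
    (∀ q : ℕ, 1 ≤ q →
      (∀ i l : ℕ, tableEntry (2 ^ q) i l = tableEntry (2 ^ q) i 0) ∧
      ∀ a : ℤ, Odd a → 1 ≤ a → a ≤ 2 ^ q →
        {i : ℕ | 1 ≤ i ∧ i ≤ 2 ^ q ∧ ∀ l : ℕ, tableEntry (2 ^ q) i l = a}.ncard = 2) ∧
    -- 9. for `k = 2 ^ q > 2`, the values of six particular rows
    (∀ q : ℕ, 2 ≤ q → ∀ l : ℕ,
      tableEntry (2 ^ q) 1 l = 1 ∧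
      tableEntry (2 ^ q) 2 l = 1 ∧
      tableEntry (2 ^ q) (2 ^ (q - 1)) l = 2 ^ (q - 1) - 1 ∧
      tableEntry (2 ^ q) (2 ^ (q - 1) + 1) l = 2 ^ (q - 1) + 1 ∧
      tableEntry (2 ^ q) (2 ^ (q - 1) + 2) l = 2 ^ (q - 1) + 1 ∧
      tableEntry (2 ^ q) (2 ^ q) l = 2 ^ q - 1) ∧
    -- 10. for `k = 2 ^ q > 2`, rows `i` and `i + 2 ^ (q - 1)` differ by `2 ^ (q - 1)` mod `2 ^ q`
    (∀ q : ℕ, 2 ≤ q → ∀ i l : ℕ,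
      tableEntry (2 ^ q) (i + 2 ^ (q - 1)) l ≡
        tableEntry (2 ^ q) i l + 2 ^ (q - 1) [ZMOD 2 ^ q]) := by
  refine ⟨odd_lineNumber, fun k hk l => tableEntry_one_eq_tableEntry_two hk l,
    fun k hk he l => tableEntry_half_rows hk he l, fun k ho l => tableEntry_middle_row ho l,
    ?_, ?_, ?_, ?_, fun q hq l => tableEntry_two_pow_special_rows hq l,
    fun q hq i l => tableEntry_two_pow_half_shift hq i l⟩
  · intro k hk i hi
    have : Fact k.Prime := ⟨hk⟩
    suffices h : tableEntry k 1 0 = 1 ∧ tableEntry k 1 1 = 1 ∧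
        ∀ l : ℕ, 2 ≤ l → l ≤ k + 1 → tableEntry k 1 l = (k : ℤ) - 1 by
      rcases hi with rfl | rfl
      · exact h
      · simpa only [tableEntry_one_eq_tableEntry_two hk.one_le] using h
    by_cases hk2 : k = 2
    · subst hk2
      have h : ∀ l, tableEntry 2 1 l = 1 := fun l => Int.odd_iff.1 (odd_lineNumber _)
      exact ⟨h 0, h 1, fun l _ _ => (h l).trans (by norm_num)⟩
    · exact tableEntry_one_prime hk2
  · intro k hk hk2 i hi hik
    have : Fact k.Prime := ⟨hk⟩
    have hodd := hk.eq_two_or_odd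
    exact tableEntry_bottom_first_column (r := 2 * i - 3 - k) (by omega) hik
  · intro k hk hk2 i hi hik l hl hl2
    have : Fact k.Prime := ⟨hk⟩
    have hodd := hk.eq_two_or_odd
    exact tableEntry_bottom_block (r := 2 * i - 3 - k) (b := 2 * l + 1 - k) (by omega) hik
      (by omega) (by omega)
  · intro q hq
    exact ⟨fun i l => by rw [tableEntry_two_pow hq, tableEntry_two_pow hq],
      fun a ha h1 h2 => ncard_constant_rows hq ha h1 h2⟩
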